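/- Let $A\in\mathbb{R}^{n\times n}$, $B\in\mathbb{R}^{n\times k}$ with $(A,B)$ controllable, i.e. $\operatorname{rank}[B,AB,\dots,A^{n-1}B]=n$. Let $R\in\mathbb{R}^{k\times k}$ and $K\in\mathbb{R}^{n\times n}$ be symmetric positive definite, let $\gamma\in[0,1)$ be a discount factor, and let $w_0,w_1,\dots$ be i.i.d. centered Gaussian vectors $N(0,W)$ in $\mathbb{R}^n$, with $W$ symmetric positive semidefinite. For $\theta\in\mathbb{R}^{k\times n}$ consider the linear policy $a_t=\theta s_t$ in the system $s_{t+1}=As_t+Ba_t+w_t$, where $s_0\sim N(0,I)$ is independent of the noise, and its total discounted cost $$\ell(\theta)=\mathbb{E}\Big[\sum_{t=0}^{\infty}\gamma^t\big(a_t^{\top}Ra_t+s_t^{\top}Ks_t\big)\Big]\in[0,\infty].$$ Let $\Theta_{\rm stable}=\{\theta\in\mathbb{R}^{k\times n}:\max_{\|x\|_2=1}\|(A+B\theta)x\|_2<1\}$. Then for every $\theta\in\Theta_{\rm stable}$ the loss $\ell$ is finite and differentiable at $\theta$ (so that $\nabla\ell(\theta)$ is well defined), and if $\nabla\ell(\theta)=0$,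 then $$\ell(\theta)=\min_{\theta'\in\mathbb{R}^{k\times n}}\ell(\theta').$$ -/

import Mathlib

open MeasureTheory ProbabilityTheory
open scoped ENNReal Matrix

/-- The data of a discounted linear quadratic control problem with states in `ℝⁿ` and actions
in `ℝᵏ`: dynamics `s_{t+1} = A s_t + B a_t + w_t` with `w_t` i.i.d. `N(0, W)`, stage cost
`aᵀ R a + sᵀ K s`, discount factor `γ`. -/
structure LQProblem (n k : ℕ) where
  A : Matrix (Fin n) (Fin n) ℝ
  B : Matrix (Fin n) (Fin k) ℝ
  R : Matrix (Fin k) (Fin k) ℝ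
  K : Matrix (Fin n) (Fin n) ℝ
  W : Matrix (Fin n) (Fin n) ℝ
  γ : ℝ

/-- A `k × n` gain matrix, from its `k * n` entries viewed as a point of Euclidean space. -/
def gainMatrix {n k : ℕ} (θ : EuclideanSpace ℝ (Fin k × Fin n)) : Matrix (Fin k) (Fin n) ℝ :=
  Matrix.of fun i j => θ (i, j)

/-- The linear policy `π_θ(s) = θ s`. -/
noncomputable def linearPolicy {n k : ℕ} (θ : EuclideanSpace ℝ (Fin k × Fin n)) :
    EuclideanSpace ℝ (Fin n) → EuclideanSpace ℝ (Fin k) :=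
  fun s => Matrix.toEuclideanLin (gainMatrix θ) s

namespace LQProblem

variable {n k : ℕ} (P : LQProblem n k)

/-- The pair `(A, B)` is controllable: the matrix `[B, AB, …, Aⁿ⁻¹B]` has rank `n`. -/
def Controllable : Prop :=
  (Matrix.of fun (i : Fin n) (p : Fin n × Fin k) => (P.A ^ (p.1 : ℕ) * P.B) i p.2).rank = n

/-- `Θ_stable`: the gains `θ` such that `‖(A + Bθ)x‖₂ < 1` for all `x` with `‖x‖₂ = 1`. By
compactness of the sphere this says that the maximum of `‖(A + Bθ)x‖₂` is less than `1`. -/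
def stableGains : Set (EuclideanSpace ℝ (Fin k × Fin n)) :=
  {θ | ∀ x : EuclideanSpace ℝ (Fin n), ‖x‖ = 1 →
    ‖Matrix.toEuclideanLin (P.A + P.B * gainMatrix θ) x‖ < 1}

/-- The stage cost `g(s, a) = aᵀ R a + sᵀ K s`. -/
noncomputable def stageCost (s : EuclideanSpace ℝ (Fin n)) (a : EuclideanSpace ℝ (Fin k)) : ℝ :=
  a.ofLp ⬝ᵥ (P.R *ᵥ a.ofLp) + s.ofLp ⬝ᵥ (P.K *ᵥ s.ofLp)

/-- The state at time `t` when policy `π` is applied from the initial state `s`, along the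
noise realization `w`. -/
noncomputable def state (π : EuclideanSpace ℝ (Fin n) → EuclideanSpace ℝ (Fin k))
    (s : EuclideanSpace ℝ (Fin n)) (w : ℕ → EuclideanSpace ℝ (Fin n)) :
    ℕ → EuclideanSpace ℝ (Fin n)
  | 0 => s
  | t + 1 => Matrix.toEuclideanLin P.A (state π s w t)
      + Matrix.toEuclideanLin P.B (π (state π s w t)) + w t

/-- The law of the noise sequence: `w_0, w_1, …` i.i.d. with law `N(0, W)`. -/
noncomputable def noiseLaw : Measure (ℕ → EuclideanSpace ℝ (Fin n)) :=
  Measure.infinitePi fun _ : ℕ => multivariateGaussian (0 : EuclideanSpace ℝ (Fin n)) P.W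

/-- The cost-to-go `J_π(s) = 𝔼_π[∑ₜ γᵗ g(s_t, π(s_t)) | s_0 = s]`, with values in `[0, ∞]`. -/
noncomputable def costToGo (π : EuclideanSpace ℝ (Fin n) → EuclideanSpace ℝ (Fin k))
    (s : EuclideanSpace ℝ (Fin n)) : ℝ≥0∞ :=
  ∫⁻ w, ∑' t : ℕ, ENNReal.ofReal
    (P.γ ^ t * P.stageCost (P.state π s w t) (π (P.state π s w t))) ∂P.noiseLaw

/-- The policy gradient loss `ℓ(θ) = ∫ J_θ(s) ρ(ds)` with `ρ = N(0, I)`. -/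
noncomputable def loss (θ : EuclideanSpace ℝ (Fin k × Fin n)) : ℝ≥0∞ :=
  ∫⁻ s, P.costToGo (linearPolicy θ) s ∂(stdGaussian (EuclideanSpace ℝ (Fin n)))

end LQProblem

/-!
Write `M = A + Bθ` and `Q = K + θᴴRθ`. The noise is centered and white, so the second moments of the
state satisfy `Σ₀ = 1`, `Σₜ₊₁ = M Σₜ Mᴴ + W`, and the loss is `∑ₜ γᵗ tr(Q Σₜ)` in `[0, ∞]`
(`LQProblem.loss_eq_tsum`).

For a symmetric `S` let the Bellman residual of `S` under `θ` be `Q + γ MᴴSM - S`. Paired with the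
second moments it telescopes: up to a boundary term `γ^T tr(S Σ_T)`, the cost of `θ` is `tr(S N)`, with
`N = 1 + γ/(1-γ) W`, plus the accumulated residuals. The boundary term vanishes as soon as the cost
is finite, because `K` is positive definite. Two consequences follow.

* If `γ ‖M‖² < 1`, an open condition that holds on the stable gains, the Lyapunov series
  `S_θ = ∑ₜ γᵗ (Mᴴ)ᵗ Q Mᵗ` has zero residual, and the loss is `tr(S_θ N)`
  (`LQProblem.loss_eq_ofReal`).
* If `S` is positive semidefinite with positive semidefinite residual under `θ'`, then the loss of
  `θ'`, finite or not, is at least `tr(S N)` (`LQProblem.ofReal_trace_le_loss`).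

The residual of `S_θ` under `θ' = θ + Δ` is `ΔᴴE + EᴴΔ + Δᴴ(R + γ BᴴS_θB)Δ` with
`E = Rθ + γ BᴴS_θM`. Hence the increment of the loss is the inner product of `Δ` with
`2 E X' + (R + γ BᴴS_θB) Δ X'`, where `X'` is the discounted sum of the second moments under `θ'`
(`LQProblem.trace_valueMatrix_sub`). Since `X'` is continuous in `θ'`, the loss is differentiable at
`θ` with gradient `2 E X` (`LQProblem.hasGradientAt_loss`). As `X` is at least `N`, it is invertible,
so a zero gradient forces `E = 0`. Then the residual of `S_θ` is positive semidefinite under every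
`θ'`, and the lower bound gives optimality among all gains.
-/

/-! ### Traces of products and the discounted Lyapunov equation -/

section LinearAlgebra

open scoped Matrix.Norms.L2Operator Topology
open Matrix

/-- The adjoint equations `X = N + γ M X Mᴴ` and `S = Q + γ Mᴴ S M` are dual: `⟨Q, X⟩ = ⟨S, N⟩` for
the trace pairing. More generally `S` need not solve its equation, the left-hand side being the
pairing of `X` with its residual. -/
lemma trace_residual_mul {n : Type*} [Fintype n] {γ : ℝ} {M N X S : Matrix n n ℝ}
    (hX : X = N + γ • (M * X * Mᴴ)) :
    ((S - γ • (Mᴴ * S * M)) * X).trace = (S * N).trace := by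
  have hN : N = X - γ • (M * X * Mᴴ) := by rw [eq_sub_iff_add_eq]; exact hX.symm
  rw [hN]
  simp only [Matrix.sub_mul, Matrix.mul_sub, trace_sub, Matrix.smul_mul, Matrix.mul_smul,
    trace_smul]
  congr 2
  rw [Matrix.mul_assoc, Matrix.mul_assoc, trace_mul_comm]
  simp only [Matrix.mul_assoc]

variable {n : Type*} [Fintype n] [DecidableEq n]

lemma Matrix.PosSemidef.trace_mul_nonneg {S T : Matrix n n ℝ} (hS : S.PosSemidef)
    (hT : T.PosSemidef) : 0 ≤ (S * T).trace := by
  open scoped MatrixOrder in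
  obtain ⟨C, rfl⟩ := CStarAlgebra.nonneg_iff_eq_star_mul_self.mp hT.nonneg
  rw [star_eq_conjTranspose, ← Matrix.mul_assoc, trace_mul_comm, ← Matrix.mul_assoc]
  exact (hS.mul_mul_conjTranspose_same C).trace_nonneg

/-- A positive definite matrix dominates a multiple of every Hermitian matrix, uniformly when both
are paired with positive semidefinite matrices. -/
lemma Matrix.PosDef.exists_trace_mul_le {K S : Matrix n n ℝ} (hK : K.PosDef)
    (hS : S.IsHermitian) :
    ∃ c : ℝ, ∀ T : Matrix n n ℝ, T.PosSemidef → (S * T).trace ≤ c * (K * T).trace := by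
  rcases isEmpty_or_nonempty n with h | h
  · exact ⟨0, fun T _ ↦ by simp [Matrix.trace]⟩
  open scoped MatrixOrder in
  obtain ⟨r, hr, hrK⟩ := (CFC.exists_pos_algebraMap_le_iff (A := Matrix n n ℝ) (a := K)
    hK.isHermitian).2 fun x hx ↦ by
      rw [hK.isHermitian.spectrum_real_eq_range_eigenvalues] at hx
      obtain ⟨i, rfl⟩ := hx
      exact hK.eigenvalues_pos i
  set b : ℝ := ∑ i, |hS.eigenvalues i|
  have hb : 0 ≤ b := Finset.sum_nonneg fun i _ ↦ abs_nonneg _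
  have hSb : S ≤ algebraMap ℝ _ b := by
    refine le_algebraMap_of_spectrum_le (fun x hx ↦ ?_) hS.isSelfAdjoint
    rw [hS.spectrum_real_eq_range_eigenvalues] at hx
    obtain ⟨i, rfl⟩ := hx
    exact (le_abs_self _).trans (Finset.single_le_sum (f := fun i ↦ |hS.eigenvalues i|)
      (fun i _ ↦ abs_nonneg _) (Finset.mem_univ i))
  refine ⟨b / r, fun T hT ↦ ?_⟩
  have h1 := (Matrix.le_iff.1 hSb).trace_mul_nonneg hT
  have h2 := (Matrix.le_iff.1 hrK).trace_mul_nonneg hT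
  simp only [Matrix.sub_mul, trace_sub, Algebra.algebraMap_eq_smul_one, Matrix.smul_mul,
    Matrix.one_mul, trace_smul, smul_eq_mul] at h1 h2
  have h3 : T.trace ≤ (K * T).trace / r := by rw [le_div_iff₀ hr]; linarith
  calc (S * T).trace ≤ b * T.trace := by linarith
    _ ≤ b * ((K * T).trace / r) := by gcongr
    _ = _ := by ring

/-- The discounted Lyapunov series `∑ₜ γᵗ Mᵗ N (Mᵗ)ᴴ`, which solves `X = N + γ M X Mᴴ` when
`γ ‖M‖² < 1`. -/
noncomputable def discountedLyapunov (γ : ℝ) (M N : Matrix n n ℝ) : Matrix n n ℝ :=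
  ∑' t : ℕ, γ ^ t • (M ^ t * N * (M ^ t)ᴴ)

lemma norm_pow_le_pow_norm_l2 (M : Matrix n n ℝ) (t : ℕ) : ‖M ^ t‖ ≤ ‖M‖ ^ t := by
  rcases isEmpty_or_nonempty n with h | h
  · rw [Subsingleton.elim (M ^ t) 0, norm_zero]; positivity
  · exact norm_pow_le _ _

lemma norm_discountedLyapunov_term_le {γ : ℝ} (hγ : 0 ≤ γ) (M N : Matrix n n ℝ) (t : ℕ) :
    ‖γ ^ t • (M ^ t * N * (M ^ t)ᴴ)‖ ≤ (γ * ‖M‖ ^ 2) ^ t * ‖N‖ := by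
  have h := norm_pow_le_pow_norm_l2 M t
  calc ‖γ ^ t • (M ^ t * N * (M ^ t)ᴴ)‖ ≤ γ ^ t * (‖M ^ t‖ * ‖N‖ * ‖M ^ t‖) := by
        rw [norm_smul, norm_pow, Real.norm_of_nonneg hγ]
        gcongr
        refine (norm_mul_le _ _).trans ?_
        rw [l2_opNorm_conjTranspose]
        gcongr
        exact norm_mul_le _ _
    _ ≤ γ ^ t * (‖M‖ ^ t * ‖N‖ * ‖M‖ ^ t) := by gcongr
    _ = _ := by ring

lemma summable_discountedLyapunov {γ : ℝ} (hγ : 0 ≤ γ) {M : Matrix n n ℝ}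
    (hM : γ * ‖M‖ ^ 2 < 1) (N : Matrix n n ℝ) :
    Summable fun t : ℕ ↦ γ ^ t • (M ^ t * N * (M ^ t)ᴴ) :=
  Summable.of_norm_bounded ((summable_geometric_of_lt_one (by positivity) hM).mul_right _)
    (norm_discountedLyapunov_term_le hγ M N)

lemma discountedLyapunov_eq {γ : ℝ} (hγ : 0 ≤ γ) {M : Matrix n n ℝ}
    (hM : γ * ‖M‖ ^ 2 < 1) (N : Matrix n n ℝ) :
    discountedLyapunov γ M N = N + γ • (M * discountedLyapunov γ M N * Mᴴ) := by
  have hs := summable_discountedLyapunov hγ hM N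
  conv_lhs => rw [discountedLyapunov, hs.tsum_eq_zero_add]
  rw [discountedLyapunov, ← hs.tsum_mul_left, ← (hs.mul_left M).tsum_mul_right,
    ← ((hs.mul_left M).mul_right Mᴴ).tsum_const_smul]
  simp only [pow_zero, Matrix.one_mul, conjTranspose_one, Matrix.mul_one, one_smul]
  congr 1
  refine tsum_congr fun t ↦ ?_
  rw [pow_succ' M, conjTranspose_mul, Matrix.mul_smul, Matrix.smul_mul, smul_smul, pow_succ']
  simp only [Matrix.mul_assoc]

lemma discountedLyapunov_posSemidef {γ : ℝ} (hγ : 0 ≤ γ) {M : Matrix n n ℝ}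
    (hM : γ * ‖M‖ ^ 2 < 1) {N : Matrix n n ℝ} (hN : N.PosSemidef) :
    (discountedLyapunov γ M N).PosSemidef := by
  have hs := (summable_discountedLyapunov hγ hM N).hasSum
  have hterm (t : ℕ) : (γ ^ t • (M ^ t * N * (M ^ t)ᴴ)).PosSemidef :=
    (hN.mul_mul_conjTranspose_same (M ^ t)).smul (by positivity)
  refine PosSemidef.of_dotProduct_mulVec_nonneg ?_ fun x ↦ ?_
  · refine (hs.matrix_conjTranspose.unique ?_ :)
    simpa only [(hterm _).isHermitian.eq, discountedLyapunov] using hs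
  · have hc : Continuous fun S : Matrix n n ℝ ↦ star x ⬝ᵥ (S *ᵥ x) := by fun_prop
    refine (isClosed_le continuous_const hc).mem_of_tendsto hs (.of_forall fun s ↦ ?_)
    exact (posSemidef_sum s fun t _ ↦ hterm t).dotProduct_mulVec_nonneg x

lemma discountedLyapunov_posDef {γ : ℝ} (hγ : 0 ≤ γ) {M : Matrix n n ℝ}
    (hM : γ * ‖M‖ ^ 2 < 1) {N : Matrix n n ℝ} (hN : N.PosDef) :
    (discountedLyapunov γ M N).PosDef := by
  rw [discountedLyapunov_eq hγ hM]
  exact hN.add_posSemidef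
    (((discountedLyapunov_posSemidef hγ hM hN.posSemidef).mul_mul_conjTranspose_same M).smul hγ)

lemma continuousAt_discountedLyapunov {γ : ℝ} (hγ : 0 ≤ γ) {M : Matrix n n ℝ}
    (hM : γ * ‖M‖ ^ 2 < 1) (N : Matrix n n ℝ) :
    ContinuousAt (fun M ↦ discountedLyapunov γ M N) M := by
  -- On the neighbourhood `γ ‖M‖² < q` the series is dominated by a geometric one of ratio `q`.
  obtain ⟨q, hq, hq1⟩ := exists_between hM
  have hc : Continuous fun M : Matrix n n ℝ ↦ γ * ‖M‖ ^ 2 := by fun_prop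
  have hopen : {M : Matrix n n ℝ | γ * ‖M‖ ^ 2 < q} ∈ 𝓝 M :=
    (isOpen_lt hc continuous_const).mem_nhds hq
  refine ContinuousOn.continuousAt ?_ hopen
  refine continuousOn_tsum (u := fun t ↦ q ^ t * ‖N‖) (fun t ↦ ?_)
    ((summable_geometric_of_lt_one ((by positivity : 0 ≤ γ * ‖M‖ ^ 2).trans hq.le) hq1).mul_right _)
    fun t M' hM' ↦ ?_
  · exact Continuous.continuousOn (by fun_prop)
  · refine (norm_discountedLyapunov_term_le hγ M' N t).trans ?_
    gcongr
    exact hM'.le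

end LinearAlgebra

/-! ### Second moments of Gaussian vectors -/

section Moments
open Matrix

lemma memLp_two_eval_multivariateGaussian {n : ℕ} (W : Matrix (Fin n) (Fin n) ℝ) (i : Fin n) :
    MemLp (fun x : EuclideanSpace ℝ (Fin n) ↦ x i) 2 (multivariateGaussian 0 W) :=
  IsGaussian.memLp_dual _ (EuclideanSpace.proj i : EuclideanSpace ℝ (Fin n) →L[ℝ] ℝ) 2 (by simp)

lemma integral_eval_multivariateGaussian {n : ℕ} (W : Matrix (Fin n) (Fin n) ℝ) (i : Fin n) :
    ∫ x : EuclideanSpace ℝ (Fin n), x i ∂(multivariateGaussian 0 W) = 0 := by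
  have := (EuclideanSpace.proj i : EuclideanSpace ℝ (Fin n) →L[ℝ] ℝ).integral_comp_comm
    (IsGaussian.integrable_fun_id (μ := multivariateGaussian 0 W))
  simpa using this

lemma integral_eval_mul_eval_multivariateGaussian {n : ℕ} {W : Matrix (Fin n) (Fin n) ℝ}
    (hW : W.PosSemidef) (i j : Fin n) :
    ∫ x : EuclideanSpace ℝ (Fin n), x i * x j ∂(multivariateGaussian 0 W) = W i j := by
  have := covariance_eval_multivariateGaussian (μ := 0) hW i j
  rw [covariance_eq_sub (memLp_two_eval_multivariateGaussian W i)
    (memLp_two_eval_multivariateGaussian W j)] at this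
  simpa [integral_eval_multivariateGaussian] using this

lemma MeasureTheory.MemLp.integrable_fun_mul {Ω : Type*} [MeasurableSpace Ω] {μ : Measure Ω}
    {f g : Ω → ℝ} (hf : MemLp f 2 μ) (hg : MemLp g 2 μ) : Integrable (fun ω ↦ f ω * g ω) μ :=
  hf.integrable_mul hg

lemma integral_sum_mul_of_memLp {Ω ι : Type*} [MeasurableSpace Ω] [Fintype ι] {μ : Measure Ω}
    {x : ι → Ω → ℝ} {g : Ω → ℝ} (hx : ∀ i, MemLp (x i) 2 μ) (hg : MemLp g 2 μ) (a : ι → ℝ) :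
    ∫ ω, (∑ i, a i * x i ω) * g ω ∂μ = ∑ i, a i * ∫ ω, x i ω * g ω ∂μ := by
  simp only [Finset.sum_mul, mul_assoc]
  rw [integral_finsetSum _ fun i _ ↦ ((hx i).integrable_fun_mul hg).const_mul _]
  simp only [integral_const_mul]

end Moments

namespace LQProblem

open Matrix

variable {n k : ℕ} (P : LQProblem n k)

/-! ### Second moments of the state -/

/-- The closed-loop matrix `A + Bθ`. -/
def closedLoop (θ : EuclideanSpace ℝ (Fin k × Fin n)) : Matrix (Fin n) (Fin n) ℝ :=
  P.A + P.B * gainMatrix θ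

/-- The matrix `K + θᴴ R θ` of the stage cost of the policy `θ`, as a quadratic form in the
state. -/
def closedLoopCost (θ : EuclideanSpace ℝ (Fin k × Fin n)) : Matrix (Fin n) (Fin n) ℝ :=
  P.K + (gainMatrix θ)ᴴ * P.R * gainMatrix θ

/-- The second-moment matrix at time `t` of the state of `s_{t+1} = M s_t + w_t`, with noise
covariance `W`, when the second-moment matrix at time `0` is `C`. -/
def secondMoment (M C : Matrix (Fin n) (Fin n) ℝ) : ℕ → Matrix (Fin n) (Fin n) ℝ
  | 0 => C
  | t + 1 => M * secondMoment M C t * Mᴴ + P.W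

lemma secondMoment_posSemidef (hW : P.W.PosSemidef) (M : Matrix (Fin n) (Fin n) ℝ)
    {C : Matrix (Fin n) (Fin n) ℝ} (hC : C.PosSemidef) (t : ℕ) :
    (P.secondMoment M C t).PosSemidef := by
  induction t with
  | zero => exact hC
  | succ t ih => exact (ih.mul_mul_conjTranspose_same M).add hW

lemma stageCost_linearPolicy (θ : EuclideanSpace ℝ (Fin k × Fin n))
    (s : EuclideanSpace ℝ (Fin n)) :
    P.stageCost s (linearPolicy θ s) = s.ofLp ⬝ᵥ (P.closedLoopCost θ *ᵥ s.ofLp) := by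
  simp only [stageCost, linearPolicy, closedLoopCost, Matrix.ofLp_toLpLin, Matrix.toLin'_apply,
    add_mulVec, dotProduct_add, conjTranspose_eq_transpose_of_trivial]
  rw [add_comm, Matrix.mul_assoc, ← mulVec_mulVec,
    dotProduct_mulVec s.ofLp (gainMatrix θ)ᵀ, vecMul_transpose, ← mulVec_mulVec]

lemma state_linearPolicy_succ (θ : EuclideanSpace ℝ (Fin k × Fin n))
    (s : EuclideanSpace ℝ (Fin n)) (w : ℕ → EuclideanSpace ℝ (Fin n)) (t : ℕ) (i : Fin n) :
    P.state (linearPolicy θ) s w (t + 1) i =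
      ∑ j, P.closedLoop θ i j * P.state (linearPolicy θ) s w t j + w t i := by
  simp only [state, linearPolicy, closedLoop, PiLp.add_apply, Matrix.ofLp_toLpLin,
    Matrix.toLin'_apply, mulVec_mulVec, Matrix.add_apply, add_mul, Finset.sum_add_distrib]
  rfl

instance : IsProbabilityMeasure P.noiseLaw := by unfold noiseLaw; infer_instance

lemma measurePreserving_noise (t : ℕ) :
    MeasurePreserving (fun w : ℕ → EuclideanSpace ℝ (Fin n) ↦ w t) P.noiseLaw
      (multivariateGaussian 0 P.W) :=
  measurePreserving_eval_infinitePi _ t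

lemma memLp_noise (t : ℕ) (i : Fin n) :
    MemLp (fun w : ℕ → EuclideanSpace ℝ (Fin n) ↦ w t i) 2 P.noiseLaw :=
  (memLp_two_eval_multivariateGaussian P.W i).comp_measurePreserving (P.measurePreserving_noise t)

lemma integral_noise (t : ℕ) (i : Fin n) : ∫ w, w t i ∂P.noiseLaw = 0 := by
  rw [← integral_eval_multivariateGaussian P.W i, ← (P.measurePreserving_noise t).map_eq,
    integral_map (measurable_pi_apply t).aemeasurable (by fun_prop)]

lemma integral_noise_mul_noise_self (hW : P.W.PosSemidef) (t : ℕ) (i j : Fin n) :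
    ∫ w, w t i * w t j ∂P.noiseLaw = P.W i j := by
  rw [← integral_eval_mul_eval_multivariateGaussian hW i j, ← (P.measurePreserving_noise t).map_eq,
    integral_map (measurable_pi_apply t).aemeasurable (by fun_prop)]

lemma integral_noise_mul_noise_of_ne {t u : ℕ} (htu : t ≠ u) (i j : Fin n) :
    ∫ w, w t i * w u j ∂P.noiseLaw = 0 := by
  have h : iIndepFun (fun t (w : ℕ → EuclideanSpace ℝ (Fin n)) ↦ w t) P.noiseLaw :=
    iIndepFun_infinitePi (X := fun _ x ↦ x) fun _ ↦ measurable_id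
  have h2 : IndepFun (fun w : ℕ → EuclideanSpace ℝ (Fin n) ↦ w t i) (fun w ↦ w u j) P.noiseLaw :=
    (h.indepFun htu).comp (φ := fun x : EuclideanSpace ℝ (Fin n) ↦ x i)
      (ψ := fun x : EuclideanSpace ℝ (Fin n) ↦ x j) (by fun_prop) (by fun_prop)
  rw [h2.integral_fun_mul_eq_mul_integral (P.memLp_noise t i).1 (P.memLp_noise u j).1,
    integral_noise, zero_mul]

lemma memLp_state (θ : EuclideanSpace ℝ (Fin k × Fin n)) (s : EuclideanSpace ℝ (Fin n)) (t : ℕ)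
    (i : Fin n) : MemLp (fun w ↦ P.state (linearPolicy θ) s w t i) 2 P.noiseLaw := by
  induction t generalizing i with
  | zero => exact memLp_const (s i)
  | succ t ih =>
    simp only [state_linearPolicy_succ]
    exact (memLp_finsetSum _ fun j _ ↦ (ih j).const_mul _).add (P.memLp_noise t i)

lemma memLp_closedLoop_state (θ : EuclideanSpace ℝ (Fin k × Fin n))
    (s : EuclideanSpace ℝ (Fin n)) (t : ℕ) (i : Fin n) :
    MemLp (fun w ↦ ∑ j, P.closedLoop θ i j * P.state (linearPolicy θ) s w t j) 2 P.noiseLaw :=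
  memLp_finsetSum _ fun j _ ↦ (P.memLp_state θ s t j).const_mul _

/-- The state at time `t` depends on the noise before time `t` only, hence is uncorrelated with the
noise from time `t` on. -/
lemma integral_state_mul_noise (θ : EuclideanSpace ℝ (Fin k × Fin n))
    (s : EuclideanSpace ℝ (Fin n)) (t : ℕ) {u : ℕ} (htu : t ≤ u) (i j : Fin n) :
    ∫ w, P.state (linearPolicy θ) s w t i * w u j ∂P.noiseLaw = 0 := by
  induction t generalizing i with
  | zero => simp only [state, integral_const_mul, integral_noise, mul_zero]
  | succ t ih =>
    have hwu := P.memLp_noise u j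
    simp only [state_linearPolicy_succ, add_mul]
    rw [integral_add ((P.memLp_closedLoop_state θ s t i).integrable_fun_mul hwu)
        ((P.memLp_noise t i).integrable_fun_mul hwu),
      integral_sum_mul_of_memLp (P.memLp_state θ s t) hwu,
      P.integral_noise_mul_noise_of_ne (by omega : t ≠ u)]
    simp only [ih (by omega : t ≤ u), mul_zero, Finset.sum_const_zero, add_zero]

/-- Conditionally on `s_0 = s`, the second-moment matrix of the state starts from `s sᵀ`. -/
lemma integral_state_mul_state (hW : P.W.PosSemidef) (θ : EuclideanSpace ℝ (Fin k × Fin n))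
    (s : EuclideanSpace ℝ (Fin n)) (t : ℕ) (i j : Fin n) :
    ∫ w, P.state (linearPolicy θ) s w t i * P.state (linearPolicy θ) s w t j ∂P.noiseLaw =
      P.secondMoment (P.closedLoop θ) (vecMulVec s.ofLp s.ofLp) t i j := by
  induction t generalizing i j with
  | zero => simp [state, secondMoment, vecMulVec_apply]
  | succ t ih =>
    have hx := P.memLp_state θ s t
    have hy := P.memLp_closedLoop_state θ s t
    have hw := P.memLp_noise t
    have hyw (i j : Fin n) : ∫ w, (∑ l, P.closedLoop θ i l * P.state (linearPolicy θ) s w t l) *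
        w t j ∂P.noiseLaw = 0 := by
      rw [integral_sum_mul_of_memLp hx (hw j)]
      simp only [P.integral_state_mul_noise θ s t le_rfl, mul_zero, Finset.sum_const_zero]
    have hwy (i j : Fin n) : ∫ w, w t i *
        (∑ l, P.closedLoop θ j l * P.state (linearPolicy θ) s w t l) ∂P.noiseLaw = 0 := by
      simpa only [mul_comm] using hyw j i
    have hyy : ∫ w, (∑ l, P.closedLoop θ i l * P.state (linearPolicy θ) s w t l) *
        (∑ l, P.closedLoop θ j l * P.state (linearPolicy θ) s w t l) ∂P.noiseLaw =
        (P.closedLoop θ * P.secondMoment (P.closedLoop θ) (vecMulVec s.ofLp s.ofLp) t *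
          (P.closedLoop θ)ᴴ) i j := by
      rw [integral_sum_mul_of_memLp hx (hy j), Matrix.mul_assoc, Matrix.mul_apply]
      refine Finset.sum_congr rfl fun l _ ↦ ?_
      have hcomm := integral_sum_mul_of_memLp hx (hx l) (P.closedLoop θ j)
      simp only [ih] at hcomm
      rw [integral_congr_ae (.of_forall fun w ↦ mul_comm _ _), hcomm, Matrix.mul_apply]
      refine congrArg _ (Finset.sum_congr rfl fun l' _ ↦ ?_)
      rw [← ih l l', ← ih l' l, mul_comm, conjTranspose_apply, star_trivial]
      simp only [mul_comm]
    simp only [state_linearPolicy_succ, add_mul, mul_add]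
    rw [integral_add (((hy i).integrable_fun_mul (hy j)).fun_add ((hw i).integrable_fun_mul (hy j)))
        (((hy i).integrable_fun_mul (hw j)).fun_add ((hw i).integrable_fun_mul (hw j))),
      integral_add ((hy i).integrable_fun_mul (hy j)) ((hw i).integrable_fun_mul (hy j)),
      integral_add ((hy i).integrable_fun_mul (hw j)) ((hw i).integrable_fun_mul (hw j)),
      hyw, hwy, hyy, P.integral_noise_mul_noise_self hW]
    simp [secondMoment]

lemma dotProduct_mulVec_eq_sum (Q : Matrix (Fin n) (Fin n) ℝ) (x : Fin n → ℝ) :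
    x ⬝ᵥ (Q *ᵥ x) = ∑ i, ∑ j, Q i j * (x j * x i) := by
  simp only [dotProduct, mulVec, Finset.mul_sum]
  exact Finset.sum_congr rfl fun i _ ↦ Finset.sum_congr rfl fun j _ ↦ by ring

lemma integral_quadraticForm {Ω : Type*} [MeasurableSpace Ω] {μ : Measure Ω}
    {x : Ω → EuclideanSpace ℝ (Fin n)} (hx : ∀ i, MemLp (fun ω ↦ x ω i) 2 μ)
    {C : Matrix (Fin n) (Fin n) ℝ} (hC : ∀ i j, ∫ ω, x ω i * x ω j ∂μ = C i j)
    (Q : Matrix (Fin n) (Fin n) ℝ) :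
    Integrable (fun ω ↦ (x ω).ofLp ⬝ᵥ (Q *ᵥ (x ω).ofLp)) μ ∧
      ∫ ω, (x ω).ofLp ⬝ᵥ (Q *ᵥ (x ω).ofLp) ∂μ = (Q * C).trace := by
  have hint (i j : Fin n) : Integrable (fun ω ↦ Q i j * (x ω j * x ω i)) μ :=
    ((hx j).integrable_mul (hx i)).const_mul _
  simp only [dotProduct_mulVec_eq_sum]
  refine ⟨integrable_finsetSum _ fun i _ ↦ integrable_finsetSum _ fun j _ ↦ hint i j, ?_⟩
  rw [integral_finsetSum _ fun i _ ↦ integrable_finsetSum _ fun j _ ↦ hint i j]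
  simp only [integral_finsetSum _ fun j _ ↦ hint _ j, integral_const_mul, hC, Matrix.trace,
    Matrix.diag, Matrix.mul_apply]

/-! ### The loss as a series of second moments -/

lemma closedLoopCost_posSemidef (hR : P.R.PosSemidef) (hK : P.K.PosSemidef)
    (θ : EuclideanSpace ℝ (Fin k × Fin n)) : (P.closedLoopCost θ).PosSemidef :=
  hK.add (hR.conjTranspose_mul_mul_same _)

/-- Only the contribution of the initial state depends on `C`, and it does so linearly. -/
lemma secondMoment_eq_add (M C : Matrix (Fin n) (Fin n) ℝ) (t : ℕ) :
    P.secondMoment M C t = M ^ t * C * (M ^ t)ᴴ + P.secondMoment M 0 t := by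
  induction t with
  | zero => simp [secondMoment]
  | succ t ih =>
    rw [secondMoment, ih, secondMoment, pow_succ', conjTranspose_mul]
    simp only [Matrix.mul_add, Matrix.add_mul, Matrix.mul_assoc, add_assoc]

/-- Averaging the conditional second moments over `s_0 ∼ N(0, 1)` replaces `s sᵀ` by its mean `1`. -/
lemma integral_trace_mul_secondMoment (M Q : Matrix (Fin n) (Fin n) ℝ) (t : ℕ) :
    Integrable (fun s : EuclideanSpace ℝ (Fin n) ↦
        (Q * P.secondMoment M (vecMulVec s.ofLp s.ofLp) t).trace) (stdGaussian _) ∧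
      ∫ s : EuclideanSpace ℝ (Fin n),
        (Q * P.secondMoment M (vecMulVec s.ofLp s.ofLp) t).trace ∂(stdGaussian _) =
      (Q * P.secondMoment M 1 t).trace := by
  have hs (C : Matrix (Fin n) (Fin n) ℝ) : (Q * P.secondMoment M C t).trace =
      (((M ^ t)ᴴ * Q * M ^ t) * C).trace + (Q * P.secondMoment M 0 t).trace := by
    rw [P.secondMoment_eq_add M C, Matrix.mul_add, trace_add, ← Matrix.mul_assoc,
      trace_mul_comm]
    simp only [Matrix.mul_assoc]
  obtain ⟨hint, heq⟩ := integral_quadraticForm (μ := stdGaussian (EuclideanSpace ℝ (Fin n)))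
    (x := fun s ↦ s) (C := 1)
    (fun i ↦ by
      rw [← multivariateGaussian_zero_one]; exact memLp_two_eval_multivariateGaussian 1 i)
    (fun i j ↦ by
      rw [← multivariateGaussian_zero_one]
      exact integral_eval_mul_eval_multivariateGaussian PosSemidef.one i j)
    ((M ^ t)ᴴ * Q * M ^ t)
  have hq (s : EuclideanSpace ℝ (Fin n)) :
      (((M ^ t)ᴴ * Q * M ^ t) * vecMulVec s.ofLp s.ofLp).trace =
        s.ofLp ⬝ᵥ (((M ^ t)ᴴ * Q * M ^ t) *ᵥ s.ofLp) := by
    rw [mul_vecMulVec, trace_vecMulVec, dotProduct_comm]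
  simp only [hs (vecMulVec _ _), hq]
  refine ⟨hint.add (integrable_const _), ?_⟩
  rw [integral_add hint (integrable_const _), heq, hs 1]
  simp

/-- The loss is determined by the second moments of the state under a random initial state with
covariance `1`. -/
lemma loss_eq_tsum (hγ0 : 0 ≤ P.γ) (hR : P.R.PosSemidef) (hK : P.K.PosSemidef)
    (hW : P.W.PosSemidef) (θ : EuclideanSpace ℝ (Fin k × Fin n)) :
    P.loss θ = ∑' t : ℕ, ENNReal.ofReal
      (P.γ ^ t * (P.closedLoopCost θ * P.secondMoment (P.closedLoop θ) 1 t).trace) := by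
  have hQ := P.closedLoopCost_posSemidef hR hK θ
  have hcost (s : EuclideanSpace ℝ (Fin n)) : P.costToGo (linearPolicy θ) s =
      ∑' t : ℕ, ENNReal.ofReal (P.γ ^ t * (P.closedLoopCost θ *
        P.secondMoment (P.closedLoop θ) (vecMulVec s.ofLp s.ofLp) t).trace) := by
    have hint (t : ℕ) := integral_quadraticForm (P.memLp_state θ s t)
      (P.integral_state_mul_state hW θ s t) (P.closedLoopCost θ)
    simp only [costToGo, stageCost_linearPolicy]
    rw [lintegral_tsum fun t ↦
      ((hint t).1.const_mul _).aestronglyMeasurable.aemeasurable.ennreal_ofReal]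
    refine tsum_congr fun t ↦ ?_
    rw [← ofReal_integral_eq_lintegral_ofReal ((hint t).1.const_mul _)
      (.of_forall fun w ↦ mul_nonneg (pow_nonneg hγ0 t) (hQ.dotProduct_mulVec_nonneg _)),
      integral_const_mul, (hint t).2]
  have hint (t : ℕ) := P.integral_trace_mul_secondMoment (P.closedLoop θ) (P.closedLoopCost θ) t
  simp only [loss, hcost]
  rw [lintegral_tsum fun t ↦
      ((hint t).1.const_mul _).aestronglyMeasurable.aemeasurable.ennreal_ofReal]
  refine tsum_congr fun t ↦ ?_
  rw [← ofReal_integral_eq_lintegral_ofReal ((hint t).1.const_mul _)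
    (.of_forall fun s ↦ mul_nonneg (pow_nonneg hγ0 t) (hQ.trace_mul_nonneg
      (P.secondMoment_posSemidef hW _ (posSemidef_vecMulVec_self_star s.ofLp) t))),
    integral_const_mul, (hint t).2]

/-! ### Bellman residuals and the value of the loss -/

open Filter
open scoped Matrix.Norms.L2Operator Topology

/-- The discounted covariance `1 + γ/(1-γ) W` injected into the system by the initial state and the
noise. -/
noncomputable def inputCov : Matrix (Fin n) (Fin n) ℝ := 1 + (P.γ / (1 - P.γ)) • P.W

lemma inputCov_posDef (hγ0 : 0 ≤ P.γ) (hγ1 : P.γ < 1) (hW : P.W.PosSemidef) :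
    P.inputCov.PosDef :=
  PosDef.one.add_posSemidef (hW.smul (div_nonneg hγ0 (sub_nonneg.2 hγ1.le)))

/-- The Bellman residual of the quadratic value function `S` under the policy `θ`. -/
noncomputable def bellmanResidual (θ : EuclideanSpace ℝ (Fin k × Fin n))
    (S : Matrix (Fin n) (Fin n) ℝ) : Matrix (Fin n) (Fin n) ℝ :=
  P.closedLoopCost θ + P.γ • ((P.closedLoop θ)ᴴ * S * P.closedLoop θ) - S

/-- Pairing the Bellman residual with the second moments telescopes. -/
lemma sum_trace_bellmanResidual (hγ1 : P.γ < 1) (θ : EuclideanSpace ℝ (Fin k × Fin n))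
    (S : Matrix (Fin n) (Fin n) ℝ) (T : ℕ) :
    ∑ t ∈ Finset.range T, P.γ ^ t *
        (P.closedLoopCost θ * P.secondMoment (P.closedLoop θ) 1 t).trace =
      ∑ t ∈ Finset.range T, P.γ ^ t *
          (P.bellmanResidual θ S * P.secondMoment (P.closedLoop θ) 1 t).trace
        + (S * P.inputCov).trace
        - P.γ ^ T * ((S * P.secondMoment (P.closedLoop θ) 1 T).trace
          + P.γ / (1 - P.γ) * (S * P.W).trace) := by
  have h1 : 1 - P.γ ≠ 0 := (sub_pos.2 hγ1).ne'
  induction T with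
  | zero =>
    simp [secondMoment, inputCov, Matrix.mul_add, trace_add]
  | succ T ih =>
    have hstep (C : Matrix (Fin n) (Fin n) ℝ) : (P.bellmanResidual θ S * C).trace =
        (P.closedLoopCost θ * C).trace
          + P.γ * (S * (P.closedLoop θ * C * (P.closedLoop θ)ᴴ)).trace - (S * C).trace := by
      have hcyc : ((P.closedLoop θ)ᴴ * S * P.closedLoop θ * C).trace =
          (S * (P.closedLoop θ * C * (P.closedLoop θ)ᴴ)).trace := by
        rw [Matrix.mul_assoc, Matrix.mul_assoc, trace_mul_comm]
        simp only [Matrix.mul_assoc]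
      simp only [bellmanResidual, Matrix.add_mul, Matrix.sub_mul, trace_add, trace_sub,
        Matrix.smul_mul, trace_smul, smul_eq_mul, hcyc]
    rw [Finset.sum_range_succ, Finset.sum_range_succ, ih, hstep, secondMoment, Matrix.mul_add,
      trace_add]
    field_simp
    ring

/-- The value matrix of a policy: when `γ ‖A + Bθ‖² < 1`, the cost-to-go of the policy is the
quadratic form of this matrix plus a constant. -/
noncomputable def valueMatrix (θ : EuclideanSpace ℝ (Fin k × Fin n)) : Matrix (Fin n) (Fin n) ℝ :=
  discountedLyapunov P.γ (P.closedLoop θ)ᴴ (P.closedLoopCost θ)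

/-- The discounted sum `∑ₜ γᵗ 𝔼[s_t s_tᵀ]` of the second moments of the state, in closed
form: when `γ ‖A + Bθ‖² < 1` it solves `X = inputCov + γ (A + Bθ) X (A + Bθ)ᴴ`. -/
noncomputable def occupancy (θ : EuclideanSpace ℝ (Fin k × Fin n)) : Matrix (Fin n) (Fin n) ℝ :=
  discountedLyapunov P.γ (P.closedLoop θ) P.inputCov

lemma bellmanResidual_valueMatrix (hγ0 : 0 ≤ P.γ) {θ : EuclideanSpace ℝ (Fin k × Fin n)}
    (hθ : P.γ * ‖P.closedLoop θ‖ ^ 2 < 1) : P.bellmanResidual θ (P.valueMatrix θ) = 0 := by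
  have h := discountedLyapunov_eq hγ0 (M := (P.closedLoop θ)ᴴ)
    (by rwa [l2_opNorm_conjTranspose]) (P.closedLoopCost θ)
  rw [conjTranspose_conjTranspose] at h
  exact sub_eq_zero.2 h.symm

lemma valueMatrix_posSemidef (hγ0 : 0 ≤ P.γ) (hR : P.R.PosSemidef) (hK : P.K.PosSemidef)
    {θ : EuclideanSpace ℝ (Fin k × Fin n)} (hθ : P.γ * ‖P.closedLoop θ‖ ^ 2 < 1) :
    (P.valueMatrix θ).PosSemidef :=
  discountedLyapunov_posSemidef hγ0 (by rwa [l2_opNorm_conjTranspose])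
    (P.closedLoopCost_posSemidef hR hK θ)

lemma discounted_cost_nonneg (hγ0 : 0 ≤ P.γ) (hR : P.R.PosSemidef) (hK : P.K.PosSemidef)
    (hW : P.W.PosSemidef) (θ : EuclideanSpace ℝ (Fin k × Fin n)) (t : ℕ) :
    0 ≤ P.γ ^ t * (P.closedLoopCost θ * P.secondMoment (P.closedLoop θ) 1 t).trace :=
  mul_nonneg (pow_nonneg hγ0 t) ((P.closedLoopCost_posSemidef hR hK θ).trace_mul_nonneg
    (P.secondMoment_posSemidef hW _ PosSemidef.one t))

/-- If the discounted cost of a policy is finite, then the discounted second moments, paired with any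
positive semidefinite `S`, tend to `0`: the stage cost dominates every quadratic form in the
state, since `K` is positive definite. -/
lemma tendsto_discounted_trace (hγ0 : 0 ≤ P.γ) (hR : P.R.PosSemidef) (hK : P.K.PosDef)
    (hW : P.W.PosSemidef) {θ : EuclideanSpace ℝ (Fin k × Fin n)}
    (hs : Summable fun t ↦
      P.γ ^ t * (P.closedLoopCost θ * P.secondMoment (P.closedLoop θ) 1 t).trace)
    {S : Matrix (Fin n) (Fin n) ℝ} (hS : S.PosSemidef) :
    Tendsto (fun t ↦ P.γ ^ t * (S * P.secondMoment (P.closedLoop θ) 1 t).trace) atTop (𝓝 0) := by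
  have hQ : (P.closedLoopCost θ).PosDef :=
    hK.add_posSemidef (hR.conjTranspose_mul_mul_same (gainMatrix θ))
  obtain ⟨c, hc⟩ := hQ.exists_trace_mul_le hS.isHermitian
  have hm := P.secondMoment_posSemidef hW (P.closedLoop θ) PosSemidef.one
  refine squeeze_zero (fun t ↦ mul_nonneg (pow_nonneg hγ0 t) (hS.trace_mul_nonneg (hm t)))
    (fun t ↦ (mul_le_mul_of_nonneg_left (hc _ (hm t)) (pow_nonneg hγ0 t)).trans_eq
      (mul_left_comm _ _ _)) ?_
  simpa using hs.tendsto_atTop_zero.const_mul c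

/-- When the discounted cost is summable, the boundary term of `sum_trace_bellmanResidual` vanishes in
the limit, so the discounted Bellman residuals add up to the cost minus the value predicted by `S`. -/
lemma tendsto_sum_bellmanResidual (hγ0 : 0 ≤ P.γ) (hγ1 : P.γ < 1) (hR : P.R.PosSemidef)
    (hK : P.K.PosDef) (hW : P.W.PosSemidef) {θ : EuclideanSpace ℝ (Fin k × Fin n)}
    (hs : Summable fun t ↦
      P.γ ^ t * (P.closedLoopCost θ * P.secondMoment (P.closedLoop θ) 1 t).trace)
    {S : Matrix (Fin n) (Fin n) ℝ} (hS : S.PosSemidef) :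
    Tendsto (fun T ↦ ∑ t ∈ Finset.range T, P.γ ^ t *
        (P.bellmanResidual θ S * P.secondMoment (P.closedLoop θ) 1 t).trace) atTop
      (𝓝 ((∑' t, P.γ ^ t * (P.closedLoopCost θ * P.secondMoment (P.closedLoop θ) 1 t).trace)
        - (S * P.inputCov).trace)) := by
  have h1 := hs.hasSum.tendsto_sum_nat
  have h2 := P.tendsto_discounted_trace hγ0 hR hK hW hs hS
  have h3 := (tendsto_pow_atTop_nhds_zero_of_lt_one hγ0 hγ1).mul_const
    (P.γ / (1 - P.γ) * (S * P.W).trace)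
  have h4 := ((h1.sub_const (S * P.inputCov).trace).add h2).add h3
  rw [zero_mul, add_zero, add_zero] at h4
  refine h4.congr fun T ↦ ?_
  rw [P.sum_trace_bellmanResidual hγ1 θ S T]
  ring

/-- The partial sums of the cost are bounded by the value, hence converge; with a vanishing residual
their limit is the value itself. -/
lemma loss_eq_ofReal (hγ0 : 0 ≤ P.γ) (hγ1 : P.γ < 1) (hR : P.R.PosSemidef)
    (hK : P.K.PosDef) (hW : P.W.PosSemidef) {θ : EuclideanSpace ℝ (Fin k × Fin n)}
    (hθ : P.γ * ‖P.closedLoop θ‖ ^ 2 < 1) :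
    P.loss θ = ENNReal.ofReal (P.valueMatrix θ * P.inputCov).trace := by
  have h0 := P.discounted_cost_nonneg hγ0 hR hK.posSemidef hW θ
  have hV := P.valueMatrix_posSemidef hγ0 hR hK.posSemidef hθ
  have hs : Summable fun t ↦
      P.γ ^ t * (P.closedLoopCost θ * P.secondMoment (P.closedLoop θ) 1 t).trace := by
    refine summable_of_sum_range_le (c := (P.valueMatrix θ * P.inputCov).trace) h0 fun T ↦ ?_
    rw [P.sum_trace_bellmanResidual hγ1 θ (P.valueMatrix θ) T,
      P.bellmanResidual_valueMatrix hγ0 hθ]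
    have h1 := hV.trace_mul_nonneg (P.secondMoment_posSemidef hW (P.closedLoop θ) PosSemidef.one T)
    have h2 := hV.trace_mul_nonneg hW
    have h3 : 0 ≤ P.γ / (1 - P.γ) := div_nonneg hγ0 (sub_nonneg.2 hγ1.le)
    have h4 : 0 ≤ P.γ ^ T * ((P.valueMatrix θ * P.secondMoment (P.closedLoop θ) 1 T).trace
          + P.γ / (1 - P.γ) * (P.valueMatrix θ * P.W).trace) := by positivity
    simpa using h4
  have h := P.tendsto_sum_bellmanResidual hγ0 hγ1 hR hK hW hs hV
  simp only [P.bellmanResidual_valueMatrix hγ0 hθ, Matrix.zero_mul, trace_zero, mul_zero,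
    Finset.sum_const_zero] at h
  rw [P.loss_eq_tsum hγ0 hR hK.posSemidef hW, ← ENNReal.ofReal_tsum_of_nonneg h0 hs,
    sub_eq_zero.1 (tendsto_nhds_unique h tendsto_const_nhds)]

/-- Verification: a quadratic value function whose Bellman residual under `θ` is positive
semidefinite bounds the loss of `θ` from below. -/
lemma ofReal_trace_le_loss (hγ0 : 0 ≤ P.γ) (hγ1 : P.γ < 1) (hR : P.R.PosSemidef)
    (hK : P.K.PosDef) (hW : P.W.PosSemidef) {θ : EuclideanSpace ℝ (Fin k × Fin n)}
    {S : Matrix (Fin n) (Fin n) ℝ} (hS : S.PosSemidef) (hres : (P.bellmanResidual θ S).PosSemidef) :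
    ENNReal.ofReal (S * P.inputCov).trace ≤ P.loss θ := by
  have h0 := P.discounted_cost_nonneg hγ0 hR hK.posSemidef hW θ
  rw [P.loss_eq_tsum hγ0 hR hK.posSemidef hW]
  by_cases hs : Summable fun t ↦
      P.γ ^ t * (P.closedLoopCost θ * P.secondMoment (P.closedLoop θ) 1 t).trace
  · rw [← ENNReal.ofReal_tsum_of_nonneg h0 hs]
    refine ENNReal.ofReal_le_ofReal (sub_nonneg.1 (ge_of_tendsto'
      (P.tendsto_sum_bellmanResidual hγ0 hγ1 hR hK hW hs hS) fun T ↦ Finset.sum_nonneg fun t _ ↦ ?_))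
    exact mul_nonneg (pow_nonneg hγ0 t) (hres.trace_mul_nonneg
      (P.secondMoment_posSemidef hW _ PosSemidef.one t))
  · rw [show ∑' t, ENNReal.ofReal (P.γ ^ t *
        (P.closedLoopCost θ * P.secondMoment (P.closedLoop θ) 1 t).trace) = ⊤ from ?_]
    · exact le_top
    · by_contra hne
      refine hs ?_
      simpa only [ENNReal.toReal_ofReal (h0 _)] using ENNReal.summable_toReal hne

/-! ### The gradient of the loss -/

/-- The matrix `E = Rθ + γ Bᴴ S (A + Bθ)`, the coefficient of the linear part, in the
increment of the gain, of the Bellman residual of `S`; see `bellmanResidual_eq_add`. -/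
def residualGradient (θ : EuclideanSpace ℝ (Fin k × Fin n)) (S : Matrix (Fin n) (Fin n) ℝ) :
    Matrix (Fin k) (Fin n) ℝ :=
  P.R * gainMatrix θ + P.γ • (P.Bᴴ * S * P.closedLoop θ)

/-- The matrix `R + γ Bᴴ S B` of the quadratic part, in the increment of the gain, of the Bellman
residual of `S`. -/
def residualHessian (S : Matrix (Fin n) (Fin n) ℝ) : Matrix (Fin k) (Fin k) ℝ :=
  P.R + P.γ • (P.Bᴴ * S * P.B)

lemma residualHessian_posSemidef (hγ0 : 0 ≤ P.γ) (hR : P.R.PosSemidef)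
    {S : Matrix (Fin n) (Fin n) ℝ} (hS : S.PosSemidef) : (P.residualHessian S).PosSemidef :=
  hR.add ((hS.conjTranspose_mul_mul_same P.B).smul hγ0)

/-- The Bellman residual is quadratic in the gain. -/
lemma bellmanResidual_eq_add (hR : P.R.IsHermitian) {S : Matrix (Fin n) (Fin n) ℝ}
    (hS : S.IsHermitian) (θ θ' : EuclideanSpace ℝ (Fin k × Fin n)) :
    P.bellmanResidual θ' S = P.bellmanResidual θ S
      + ((gainMatrix (θ' - θ))ᴴ * P.residualGradient θ S
        + (P.residualGradient θ S)ᴴ * gainMatrix (θ' - θ)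
        + (gainMatrix (θ' - θ))ᴴ * P.residualHessian S * gainMatrix (θ' - θ)) := by
  have hg : gainMatrix θ' = gainMatrix θ + gainMatrix (θ' - θ) := by
    ext i j; simp [gainMatrix]
  generalize gainMatrix (θ' - θ) = D at hg
  have hM : P.closedLoop θ' = P.closedLoop θ + P.B * D := by
    rw [closedLoop, closedLoop, hg, Matrix.mul_add, add_assoc]
  simp only [bellmanResidual, closedLoopCost, residualGradient, residualHessian, hM, hg,
    conjTranspose_add, conjTranspose_mul, conjTranspose_smul, star_trivial, hR.eq, hS.eq,
    conjTranspose_conjTranspose, Matrix.add_mul, Matrix.mul_add, Matrix.smul_mul, Matrix.mul_smul,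
    smul_add, Matrix.mul_assoc]
  abel

/-- The gradient of the loss at `θ' = θ`, and for general `θ'` the vector representing the
increment of the loss from `θ` to `θ'`; see `trace_valueMatrix_sub`. -/
noncomputable def lossSlope (θ θ' : EuclideanSpace ℝ (Fin k × Fin n)) :
    EuclideanSpace ℝ (Fin k × Fin n) :=
  WithLp.toLp 2 fun p ↦ ((2 : ℝ) • (P.residualGradient θ (P.valueMatrix θ) * P.occupancy θ')
    + P.residualHessian (P.valueMatrix θ) * gainMatrix (θ' - θ) * P.occupancy θ') p.1 p.2

lemma inner_toLp_eq_trace (Y : Matrix (Fin k) (Fin n) ℝ) (v : EuclideanSpace ℝ (Fin k × Fin n)) :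
    inner ℝ (WithLp.toLp 2 fun p : Fin k × Fin n ↦ Y p.1 p.2) v = ((gainMatrix v)ᴴ * Y).trace := by
  simp only [PiLp.inner_apply, Fintype.sum_prod_type, Matrix.trace, Matrix.diag, Matrix.mul_apply,
    conjTranspose_apply, gainMatrix, Matrix.of_apply, star_trivial]
  rw [Finset.sum_comm]
  simp

/-- The performance difference identity: the increment of the loss between two stable gains is the
Bellman residual of the value of the first, averaged over the states visited by the second. -/
lemma trace_valueMatrix_sub (hγ0 : 0 ≤ P.γ) (hγ1 : P.γ < 1) (hR : P.R.PosSemidef)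
    (hK : P.K.PosSemidef) (hW : P.W.PosSemidef) {θ θ' : EuclideanSpace ℝ (Fin k × Fin n)}
    (hθ : P.γ * ‖P.closedLoop θ‖ ^ 2 < 1) (hθ' : P.γ * ‖P.closedLoop θ'‖ ^ 2 < 1) :
    (P.valueMatrix θ' * P.inputCov).trace - (P.valueMatrix θ * P.inputCov).trace =
      inner ℝ (P.lossSlope θ θ') (θ' - θ) := by
  have hV := P.valueMatrix_posSemidef hγ0 hR hK hθ
  have hX : (P.occupancy θ').PosSemidef :=
    discountedLyapunov_posSemidef hγ0 hθ' (P.inputCov_posDef hγ0 hγ1 hW).posSemidef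
  have hXeq : P.occupancy θ' = P.inputCov + P.γ • (P.closedLoop θ' * P.occupancy θ' *
    (P.closedLoop θ')ᴴ) := discountedLyapunov_eq hγ0 hθ' _
  have h' := P.bellmanResidual_valueMatrix hγ0 hθ'
  have hres := P.bellmanResidual_eq_add hR.isHermitian hV.isHermitian θ θ'
  rw [P.bellmanResidual_valueMatrix hγ0 hθ, zero_add] at hres
  have hQ : P.closedLoopCost θ' = P.valueMatrix θ' - P.γ • ((P.closedLoop θ')ᴴ *
      P.valueMatrix θ' * P.closedLoop θ') := by
    rw [eq_sub_iff_add_eq]; exact sub_eq_zero.1 h'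
  -- Both traces are residual pairings against the same `occupancy θ'`, which solves the Lyapunov
  -- equation of `θ'`.
  have hstart : (P.valueMatrix θ' * P.inputCov).trace - (P.valueMatrix θ * P.inputCov).trace =
      (P.bellmanResidual θ' (P.valueMatrix θ) * P.occupancy θ').trace := by
    rw [← trace_residual_mul hXeq, ← trace_residual_mul hXeq, ← trace_sub, ← Matrix.sub_mul,
      bellmanResidual, hQ]
    congr 2
    abel
  have hsymm : ((P.residualGradient θ (P.valueMatrix θ))ᴴ * gainMatrix (θ' - θ) *
      P.occupancy θ').trace = ((gainMatrix (θ' - θ))ᴴ * P.residualGradient θ (P.valueMatrix θ) *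
      P.occupancy θ').trace := by
    rw [← star_trivial (trace _), ← trace_conjTranspose]
    simp only [conjTranspose_mul, conjTranspose_conjTranspose, hX.isHermitian.eq]
    rw [trace_mul_comm]
  rw [hstart, hres, lossSlope, inner_toLp_eq_trace, Matrix.add_mul, Matrix.add_mul, trace_add,
    trace_add, hsymm, Matrix.mul_add, trace_add, Matrix.mul_smul, trace_smul, smul_eq_mul]
  simp only [Matrix.mul_assoc]
  ring

lemma continuous_gainMatrix :
    Continuous (gainMatrix : EuclideanSpace ℝ (Fin k × Fin n) → Matrix (Fin k) (Fin n) ℝ) := by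
  refine continuous_matrix fun i j ↦ ?_
  simp only [gainMatrix, Matrix.of_apply]
  fun_prop

lemma continuous_closedLoop : Continuous P.closedLoop :=
  continuous_const.add (continuous_const.matrix_mul continuous_gainMatrix)

lemma continuousAt_lossSlope (hγ0 : 0 ≤ P.γ) {θ : EuclideanSpace ℝ (Fin k × Fin n)}
    (hθ : P.γ * ‖P.closedLoop θ‖ ^ 2 < 1) : ContinuousAt (P.lossSlope θ) θ := by
  have hX : ContinuousAt P.occupancy θ :=
    (continuousAt_discountedLyapunov hγ0 hθ P.inputCov).comp (f := P.closedLoop)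
      P.continuous_closedLoop.continuousAt
  have hD : ContinuousAt (fun θ' ↦ gainMatrix (θ' - θ)) θ :=
    (continuous_gainMatrix.comp (continuous_id.sub continuous_const)).continuousAt
  have hY : ContinuousAt (fun θ' ↦ (2 : ℝ) • (P.residualGradient θ (P.valueMatrix θ) *
      P.occupancy θ') + P.residualHessian (P.valueMatrix θ) * gainMatrix (θ' - θ) *
      P.occupancy θ') θ := by
    have hmul : Continuous fun q : Matrix (Fin k) (Fin n) ℝ × Matrix (Fin n) (Fin n) ℝ ↦
        (2 : ℝ) • (P.residualGradient θ (P.valueMatrix θ) * q.2)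
          + P.residualHessian (P.valueMatrix θ) * q.1 * q.2 := by fun_prop
    exact hmul.continuousAt.comp (f := fun θ' ↦ (gainMatrix (θ' - θ), P.occupancy θ'))
      (hD.prodMk hX)
  refine (PiLp.continuous_toLp 2 _).continuousAt.comp (continuousAt_pi.2 fun p ↦ ?_)
  exact ((continuous_id.matrix_elem p.1 p.2).continuousAt).comp hY

/-- A function whose increments are `⟪c x', x' - x⟫` with `c` continuous at `x` has gradient `c x`
at `x`. -/
lemma hasGradientAt_of_continuousAt_slope {F : Type*} [NormedAddCommGroup F]
    [InnerProductSpace ℝ F] [CompleteSpace F] {f : F → ℝ} {c : F → F} {x : F}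
    (hc : ContinuousAt c x) (hf : ∀ᶠ x' in 𝓝 x, f x' - f x = inner ℝ (c x') (x' - x)) :
    HasGradientAt f (c x) x := by
  rw [hasGradientAt_iff_isLittleO, Asymptotics.isLittleO_iff]
  intro ε hε
  filter_upwards [hf, Metric.tendsto_nhds.1 hc ε hε] with x' hx' hε'
  rw [hx', ← inner_sub_left]
  refine (norm_inner_le_norm _ _).trans ?_
  gcongr
  rw [← dist_eq_norm]
  exact hε'.le

lemma eventually_stable {θ : EuclideanSpace ℝ (Fin k × Fin n)}
    (hθ : P.γ * ‖P.closedLoop θ‖ ^ 2 < 1) :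
    ∀ᶠ θ' in 𝓝 θ, P.γ * ‖P.closedLoop θ'‖ ^ 2 < 1 :=
  (continuous_const.mul (P.continuous_closedLoop.norm.pow 2)).continuousAt.eventually_lt
    continuousAt_const hθ

lemma hasGradientAt_loss (hγ0 : 0 ≤ P.γ) (hγ1 : P.γ < 1) (hR : P.R.PosSemidef)
    (hK : P.K.PosDef) (hW : P.W.PosSemidef) {θ : EuclideanSpace ℝ (Fin k × Fin n)}
    (hθ : P.γ * ‖P.closedLoop θ‖ ^ 2 < 1) :
    HasGradientAt (fun θ' ↦ (P.loss θ').toReal) (P.lossSlope θ θ) θ := by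
  have hloss {θ' : EuclideanSpace ℝ (Fin k × Fin n)} (hθ' : P.γ * ‖P.closedLoop θ'‖ ^ 2 < 1) :
      (P.loss θ').toReal = (P.valueMatrix θ' * P.inputCov).trace := by
    rw [P.loss_eq_ofReal hγ0 hγ1 hR hK hW hθ', ENNReal.toReal_ofReal]
    exact (P.valueMatrix_posSemidef hγ0 hR hK.posSemidef hθ').trace_mul_nonneg
      (P.inputCov_posDef hγ0 hγ1 hW).posSemidef
  refine hasGradientAt_of_continuousAt_slope (P.continuousAt_lossSlope hγ0 hθ) ?_
  filter_upwards [P.eventually_stable hθ] with θ' hθ'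
  rw [hloss hθ, hloss hθ', P.trace_valueMatrix_sub hγ0 hγ1 hR hK.posSemidef hW hθ hθ']

/-- The discounted second-moment matrix is invertible, so a stationary gain satisfies the first
order condition of the Bellman equation in every state. -/
lemma residualGradient_eq_zero (hγ0 : 0 ≤ P.γ) (hγ1 : P.γ < 1) (hW : P.W.PosSemidef)
    {θ : EuclideanSpace ℝ (Fin k × Fin n)} (hθ : P.γ * ‖P.closedLoop θ‖ ^ 2 < 1)
    (h : P.lossSlope θ θ = 0) : P.residualGradient θ (P.valueMatrix θ) = 0 := by
  have hX : IsUnit (P.occupancy θ) :=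
    (discountedLyapunov_posDef hγ0 hθ (P.inputCov_posDef hγ0 hγ1 hW)).isUnit
  have hEX : P.residualGradient θ (P.valueMatrix θ) * P.occupancy θ = 0 := by
    have h0 : gainMatrix (0 : EuclideanSpace ℝ (Fin k × Fin n)) = 0 := rfl
    ext i j
    have hij := congrArg (fun v : EuclideanSpace ℝ (Fin k × Fin n) ↦ v (i, j)) h
    simpa [lossSlope, h0] using hij
  have hdet := (Matrix.isUnit_iff_isUnit_det _).1 hX
  rw [← Matrix.mul_nonsing_inv_cancel_right _ (P.residualGradient θ (P.valueMatrix θ)) hdet, hEX,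
    Matrix.zero_mul]

/-- Stability gives `‖A + Bθ‖ ≤ 1`, and the discount makes the inequality strict. The condition
`γ ‖A + Bθ‖² < 1` is open in `θ`. -/
lemma discount_mul_norm_sq_lt_one (hγ0 : 0 ≤ P.γ) (hγ1 : P.γ < 1)
    {θ : EuclideanSpace ℝ (Fin k × Fin n)} (hθ : θ ∈ P.stableGains) :
    P.γ * ‖P.closedLoop θ‖ ^ 2 < 1 := by
  have h : ‖P.closedLoop θ‖ ≤ 1 := by
    rw [l2_opNorm_def]
    exact ContinuousLinearMap.opNorm_le_of_unit_norm zero_le_one fun x hx ↦ (hθ x hx).le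
  calc P.γ * ‖P.closedLoop θ‖ ^ 2 ≤ P.γ * 1 :=
        mul_le_mul_of_nonneg_left (pow_le_one₀ (norm_nonneg _) h) hγ0
    _ < 1 := by rwa [mul_one]

end LQProblem

/-! ### Stationary gains are optimal -/

theorem mainTheorem4 {n k : ℕ} (P : LQProblem n k)
    (hγ0 : 0 ≤ P.γ) (hγ1 : P.γ < 1)
    (hR : P.R.PosDef) (hK : P.K.PosDef) (hW : P.W.PosSemidef)
    (hAB : P.Controllable)
    (θ : EuclideanSpace ℝ (Fin k × Fin n)) (hθ : θ ∈ P.stableGains) :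
    P.loss θ < ⊤ ∧
    DifferentiableAt ℝ (fun θ' => (P.loss θ').toReal) θ ∧
    (gradient (fun θ' => (P.loss θ').toReal) θ = 0 →
      ∀ θ' : EuclideanSpace ℝ (Fin k × Fin n), P.loss θ ≤ P.loss θ') := by
  have hθ1 := P.discount_mul_norm_sq_lt_one hγ0 hγ1 hθ
  have hloss := P.loss_eq_ofReal hγ0 hγ1 hR.posSemidef hK hW hθ1
  have hgrad := P.hasGradientAt_loss hγ0 hγ1 hR.posSemidef hK hW hθ1
  refine ⟨hloss ▸ ENNReal.ofReal_lt_top, hgrad.differentiableAt, fun h θ' ↦ ?_⟩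
  have hE := P.residualGradient_eq_zero hγ0 hγ1 hW hθ1 (hgrad.gradient.symm.trans h)
  have hV := P.valueMatrix_posSemidef hγ0 hR.posSemidef hK.posSemidef hθ1
  rw [hloss]
  refine P.ofReal_trace_le_loss hγ0 hγ1 hR.posSemidef hK hW hV ?_
  -- Completing the square: without its linear term the residual is a positive semidefinite form.
  rw [P.bellmanResidual_eq_add hR.isHermitian hV.isHermitian θ θ',
    P.bellmanResidual_valueMatrix hγ0 hθ1, hE, Matrix.conjTranspose_zero, Matrix.mul_zero,
    Matrix.zero_mul, zero_add, zero_add, zero_add]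
  exact (P.residualHessian_posSemidef hγ0 hR.posSemidef hV).conjTranspose_mul_mul_same _
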